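/- Let $G$ be a discrete group acting by homeomorphisms on a non-empty Hausdorff space $X$ that has a basis of compact open sets. Assume that the action is topologically free, i.e. for each $g\in G$ with $g\neq 1$ the fixed point set $\{x\in X : gx=x\}$ is nowhere dense in $X$. Let $R$ be a commutative ring with unit. Let $C_c(X,R)$ be the ring of compactly supported, locally constant functions $X\to R$ with pointwise operations, on which $G$ acts by $(g\cdot f)(x)=f(g^{-1}x)$, and let $C_c(X,R)\rtimes G$ be the algebraic crossed product: the (not necessarily unital) ring of finite formal sums $\sum_{g\in G} f_g\,\delta_g$ with $f_g\in C_c(X,R)$ and multiplication determined by $(f\delta_g)(f'\delta_h)=f\,(g\cdot f')\,\delta_{gh}$. A ring $A$ is prime if $A\neq 0$ and, for all two-sided ideals $I,J$ of $A$, $IJ=0$ implies $I=0$ or $J=0$. It is primitive if it has a faithful irreducible representation, i.e. a faithful left $A$-module $M$ with $AM\neq 0$ whose only submodules are $0$ and $M$. The action is topologically transitive if for all non-empty open $U,V\subseteq X$ there is $g\in G$ with $gU\cap V\neq\emptyset$. Then: 1. $C_c(X,R)\rtimes G$ is prime if and only if $R$ is an integral domain and the action of $G$ on $X$ is topologically transitive.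 2. If $R$ is a field, then $C_c(X,R)\rtimes G$ is primitive if and only if $G$ has a dense orbit on $X$. 3. If $R$ is a field and $X$ is second countable, then $C_c(X,R)\rtimes G$ is prime if and only if it is primitive. -/

import Mathlib

/-- The locally constant functions `X → R` with compact support, as a non-unital subalgebra of all
locally constant functions with the pointwise operations. -/
def locConstCcSubalgebra (X R : Type*) [TopologicalSpace X] [CommRing R] :
    NonUnitalSubalgebra R (LocallyConstant X R) where
  carrier := {f | HasCompactSupport (f : X → R)}
  add_mem' := fun ha hb => HasCompactSupport.add ha hb
  zero_mem' := HasCompactSupport.zero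
  mul_mem' := fun ha _ => HasCompactSupport.mul_right ha
  smul_mem' := fun r f hf => by
    have h : HasCompactSupport (f : X → R) := hf
    exact h.mono (fun x hx hfx => hx (by simp [hfx]))

/-- The ring `C_c(X, R)` of locally constant functions `X → R` with compact support, with the
pointwise operations. -/
def LocConstCc (X R : Type*) [TopologicalSpace X] [CommRing R] : Type _ :=
  locConstCcSubalgebra X R

namespace LocConstCc

section Ring

variable {X R : Type*} [TopologicalSpace X] [CommRing R]

instance instNonUnitalCommRing : NonUnitalCommRing (LocConstCc X R) :=
  inferInstanceAs (NonUnitalCommRing (locConstCcSubalgebra X R))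

instance instFunLike : FunLike (LocConstCc X R) X R where
  coe f := (f.1 : X → R)
  coe_injective _ _ h := Subtype.ext (DFunLike.coe_injective h)

/-- The element of `C_c(X, R)` given by a locally constant function with compact support. -/
def mk (f : X → R) (hf : IsLocallyConstant f) (hc : HasCompactSupport f) : LocConstCc X R :=
  ⟨⟨f, hf⟩, hc⟩

@[ext]
theorem ext {f f' : LocConstCc X R} (h : ∀ x, f x = f' x) : f = f' :=
  DFunLike.ext _ _ h

theorem mk_apply (f : X → R) (hf : IsLocallyConstant f) (hc : HasCompactSupport f) (x : X) :
    mk f hf hc x = f x := rfl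

theorem isLocallyConstant (f : LocConstCc X R) : IsLocallyConstant (f : X → R) :=
  f.1.isLocallyConstant

theorem hasCompactSupport (f : LocConstCc X R) : HasCompactSupport (f : X → R) := f.2

theorem zero_apply (x : X) : (0 : LocConstCc X R) x = 0 := rfl

theorem add_apply (f f' : LocConstCc X R) (x : X) : (f + f') x = f x + f' x := rfl

theorem mul_apply (f f' : LocConstCc X R) (x : X) : (f * f') x = f x * f' x := rfl

end Ring

section Action

variable {G X R : Type*} [Group G] [TopologicalSpace X] [MulAction G X] [ContinuousConstSMul G X]
  [CommRing R]

/-- The induced action of `G` on `C_c(X, R)`: `(g • f) x = f (g⁻¹ • x)`. -/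
instance instSMul : SMul G (LocConstCc X R) where
  smul g f := mk (fun x => f (g⁻¹ • x))
    (f.isLocallyConstant.comp_continuous (continuous_const_smul g⁻¹))
    (f.hasCompactSupport.comp_homeomorph (Homeomorph.smul g⁻¹))

theorem smul_apply (g : G) (f : LocConstCc X R) (x : X) : (g • f) x = f (g⁻¹ • x) := rfl

instance instDistribMulAction : DistribMulAction G (LocConstCc X R) where
  one_smul f := by ext x; simp [smul_apply]
  mul_smul g h f := by ext x; simp [smul_apply, mul_smul]
  smul_zero _ := rfl
  smul_add _ _ _ := rfl

theorem smul_mul (g : G) (f f' : LocConstCc X R) : g • (f * f') = g • f * g • f' := rfl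

end Action

end LocConstCc

/-- The (algebraic) crossed product `C_c(X, R) ⋊ G`: finite formal sums `∑ f_g δ_g` with
coefficients `f_g ∈ C_c(X, R)`, with the multiplication
`(f δ_g) (f' δ_h) = (f * (g • f')) δ_{g h}` of the skew group ring. -/
abbrev CrossedProduct (R G X : Type*) [Group G] [TopologicalSpace X] [MulAction G X]
    [ContinuousConstSMul G X] [CommRing R] : Type _ :=
  SkewMonoidAlgebra (LocConstCc X R) G

/-- The skew group ring multiplication is associative, also for non-unital coefficients. -/
theorem skewMonoidAlgebra_mul_assoc {k G : Type*} [NonUnitalSemiring k] [Group G]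
    [DistribMulAction G k] (hk : ∀ (g : G) (a b : k), g • (a * b) = g • a * g • b)
    (a b c : SkewMonoidAlgebra k G) : a * b * c = a * (b * c) := by
  induction a using SkewMonoidAlgebra.induction_on with
  | zero => simp
  | add a a' ha ha' => simp [add_mul, ha, ha']
  | single g f =>
    induction b using SkewMonoidAlgebra.induction_on with
    | zero => simp
    | add b b' hb hb' => simp [add_mul, mul_add, hb, hb']
    | single g' f' =>
      induction c using SkewMonoidAlgebra.induction_on with
      | zero => simp
      | add c c' hc hc' => simp only [mul_add, hc, hc']
      | single g'' f'' => simp [SkewMonoidAlgebra.mul_def, hk, mul_smul, mul_assoc]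

section CrossedProduct

variable {R G X : Type*} [Group G] [TopologicalSpace X] [MulAction G X] [ContinuousConstSMul G X]
  [CommRing R]

/-- The non-unital ring structure of the crossed product, on the addition and multiplication of
the skew monoid algebra. -/
noncomputable instance CrossedProduct.instNonUnitalRing : NonUnitalRing (CrossedProduct R G X) where
  __ := SkewMonoidAlgebra.instAddCommGroup
  __ := SkewMonoidAlgebra.instNonUnitalNonAssocSemiring
  mul_assoc := skewMonoidAlgebra_mul_assoc LocConstCc.smul_mul

theorem CrossedProduct.single_mul_single (g h : G) (f f' : LocConstCc X R) :
    (SkewMonoidAlgebra.single g f * SkewMonoidAlgebra.single h f' : CrossedProduct R G X) =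
      SkewMonoidAlgebra.single (g * h) (f * g • f') := by
  simp [SkewMonoidAlgebra.mul_def]

end CrossedProduct

/-- A (possibly non-unital) ring is prime if it is nonzero and `I J = 0` implies `I = 0` or `J = 0`
for two-sided ideals `I`, `J`. -/
def IsPrimeRing (A : Type*) [NonUnitalRing A] : Prop :=
  Nontrivial A ∧ ∀ I J : TwoSidedIdeal A,
    (∀ a ∈ I, ∀ b ∈ J, a * b = 0) → I = ⊥ ∨ J = ⊥

/-- A (possibly non-unital) ring `A` is (left) primitive if it has a faithful irreducible
representation: a left `A`-module `M`, given by `ρ : A → End M`, with `ρ` injective, `A M ≠ 0` and no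
`A`-submodules besides `0` and `M`. Every such `M` is a quotient of `A` as a left `A`-module, so
modules in the universe of `A` suffice. -/
def IsPrimitiveRing.{u} (A : Type u) [NonUnitalRing A] : Prop :=
  ∃ (M : Type u) (_ : AddCommGroup M) (ρ : A →ₙ+* AddMonoid.End M),
    Function.Injective ρ ∧ (∃ a m, ρ a m ≠ 0) ∧
      ∀ N : AddSubgroup M, (∀ a, ∀ m ∈ N, ρ a m ∈ N) → N = ⊥ ∨ N = ⊤

/-- An action on a topological space is topologically free if the fixed point set of each
non-identity element is nowhere dense. -/
def IsTopologicallyFree (G X : Type*) [Group G] [TopologicalSpace X] [MulAction G X] : Prop :=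
  ∀ g : G, g ≠ 1 → IsNowhereDense (MulAction.fixedBy X g)

/-!
For a topologically free action the diagonal `C_c(X, R) δ_1` meets every nonzero two-sided ideal
of the crossed product: after a right translation an element `b = ∑ f_g δ_g` of the ideal has
`f_1 ≠ 0`, and on a small compact open set `V` on which `f_1` is a constant `r ≠ 0` and which is
moved off itself by the finitely many other `g` in the support, `1_V b 1_V = r 1_V δ_1`
(`CrossedProduct.exists_single_one_indicator_mem`).

Primeness. Given nonzero ideals containing `r 1_V δ_1` and `s 1_W δ_1`, transitivity supplies `g`
with `g V ∩ W` nonempty, and inserting `1_V δ_{g⁻¹}` between the two gives a nonzero product when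
`R` is a domain. Conversely, a `G`-invariant family of ideals of `R` indexed by `X` defines an ideal
of the crossed product (`CrossedProduct.coeffIdeal`); constant families `(r)`, `(s)` with `r s = 0`
and families supported on disjoint invariant open sets yield zero products.

Primitivity. The free module on a dense orbit is irreducible over a field, because compact open sets
separate points, and faithful, because its kernel would otherwise contain some `r 1_V δ_1` while `V`
meets the orbit. Conversely, let `m` be a vector of a faithful irreducible module which is not
annihilated by the ring. By compactness some point `x` satisfies `1_W m ≠ 0` for all compact open
`W` containing `x`. If the orbit of `x` missed a nonempty compact open `V`, then `m = a 1_V m'` for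
some `a` and `m'`, whereas `1_W a 1_V = 0` for small `W` around `x`.

In the second countable case the Baire category theorem turns transitivity into a dense orbit.
-/

open TopologicalSpace Topology Set

/-! ### Indicator functions of compact open sets -/

section Indicator

variable {G X R : Type*} [TopologicalSpace X] [CommRing R]

theorem exists_compactOpens_mem_subset
    (hbasis : IsTopologicalBasis {U : Set X | IsCompact U ∧ IsOpen U})
    {x : X} {s : Set X} (hs : s ∈ 𝓝 x) : ∃ U : CompactOpens X, x ∈ U ∧ (U : Set X) ⊆ s := by
  obtain ⟨U, ⟨hc, ho⟩, hx, hU⟩ := hbasis.mem_nhds_iff.1 hs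
  exact ⟨⟨⟨U, hc⟩, ho⟩, hx, hU⟩

theorem locallyCompactSpace_of_compactOpen_basis
    (hbasis : IsTopologicalBasis {U : Set X | IsCompact U ∧ IsOpen U}) :
    LocallyCompactSpace X := by
  refine ⟨fun x s hs => ?_⟩
  obtain ⟨U, hx, hU⟩ := exists_compactOpens_mem_subset hbasis hs
  exact ⟨U, U.isOpen.mem_nhds hx, hU, U.isCompact⟩

variable [T2Space X]

/-- The function `r 1_U` in `C_c(X, R)`, for `U` compact open. -/
noncomputable def LocConstCc.indicator (U : CompactOpens X) (r : R) : LocConstCc X R :=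
  .mk ((U : Set X).indicator fun _ => r)
    ((IsLocallyConstant.iff_exists_open _).2 fun x => by
      by_cases hx : x ∈ U
      · refine ⟨U, U.isOpen, hx, fun y hy => ?_⟩
        rw [Set.indicator_of_mem hy, Set.indicator_of_mem (s := (U : Set X)) hx]
      · refine ⟨(U : Set X)ᶜ, U.isCompact.isClosed.isOpen_compl, hx, fun y hy => ?_⟩
        rw [Set.indicator_of_notMem hy, Set.indicator_of_notMem (s := (U : Set X)) hx])
    (HasCompactSupport.intro U.isCompact fun _ hx => Set.indicator_of_notMem hx _)

theorem LocConstCc.indicator_of_mem {U : CompactOpens X} {x : X} (hx : x ∈ U) (r : R) :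
    indicator U r x = r :=
  Set.indicator_of_mem (s := (U : Set X)) hx fun _ => r

theorem LocConstCc.indicator_of_notMem {U : CompactOpens X} {x : X} (hx : x ∉ U) (r : R) :
    indicator U r x = 0 :=
  Set.indicator_of_notMem (s := (U : Set X)) hx fun _ => r

theorem LocConstCc.indicator_mul_indicator_of_le {U V : CompactOpens X} (hUV : U ≤ V) :
    indicator U 1 * indicator V 1 = indicator U (1 : R) := by
  ext x
  rw [mul_apply]
  by_cases hx : x ∈ U
  · rw [indicator_of_mem hx, indicator_of_mem (hUV hx), one_mul]
  · rw [indicator_of_notMem hx, zero_mul]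

theorem LocConstCc.indicator_sup (U V : CompactOpens X) (r : R) :
    indicator (U ⊔ V) r = indicator U r + indicator (V \ U) r := by
  ext x
  rw [add_apply]
  by_cases hU : x ∈ U
  · rw [indicator_of_mem hU, indicator_of_mem (Or.inl hU),
      indicator_of_notMem (fun h : x ∈ (V : Set X) \ U => h.2 hU), add_zero]
  · rw [indicator_of_notMem hU, zero_add]
    by_cases hV : x ∈ V
    · rw [indicator_of_mem (Or.inr hV),
        indicator_of_mem (show x ∈ (V : Set X) \ U from ⟨hV, hU⟩)]
    · rw [indicator_of_notMem (fun h : x ∈ (U : Set X) ∪ V => h.elim hU hV),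
        indicator_of_notMem (fun h : x ∈ (V : Set X) \ U => hV h.1)]

end Indicator

/-! ### Coefficients of products in the crossed product -/

namespace CrossedProduct

open SkewMonoidAlgebra

variable {G X R : Type*} [Group G] [TopologicalSpace X] [MulAction G X] [ContinuousConstSMul G X]
  [CommRing R]

theorem coeff_single_mul (g : G) (f : LocConstCc X R) (a : CrossedProduct R G X) (h : G) (x : X) :
    (single g f * a).coeff h x = f x * a.coeff (g⁻¹ * h) (g⁻¹ • x) := by
  classical
  induction a using SkewMonoidAlgebra.induction_on with
  | zero => simp [LocConstCc.zero_apply]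
  | add a b ha hb =>
    simp [mul_add (R := CrossedProduct R G X), mul_add (R := R), LocConstCc.add_apply, ha, hb]
  | single k f' =>
    rw [single_mul_single, coeff_single_apply, coeff_single_apply]
    by_cases hk : g * k = h
    · simp [← hk, LocConstCc.mul_apply, LocConstCc.smul_apply]
    · rw [if_neg hk, if_neg (fun hk' => hk (by simp [hk']))]
      simp [LocConstCc.zero_apply]

theorem coeff_mul_single (g : G) (f : LocConstCc X R) (a : CrossedProduct R G X) (h : G) (x : X) :
    (a * single g f).coeff h x = a.coeff (h * g⁻¹) x * f ((h * g⁻¹)⁻¹ • x) := by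
  classical
  induction a using SkewMonoidAlgebra.induction_on with
  | zero => simp [LocConstCc.zero_apply]
  | add a b ha hb =>
    simp [add_mul (R := CrossedProduct R G X), add_mul (R := R), LocConstCc.add_apply, ha, hb]
  | single k f' =>
    rw [single_mul_single, coeff_single_apply, coeff_single_apply]
    by_cases hk : k * g = h
    · simp [← hk, LocConstCc.mul_apply, LocConstCc.smul_apply]
    · rw [if_neg hk, if_neg (fun hk' => hk (by simp [hk']))]
      simp [LocConstCc.zero_apply]

theorem coeff_single_one_mul_mul_single_one (f f' : LocConstCc X R) (a : CrossedProduct R G X)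
    (h : G) (x : X) :
    (single 1 f * a * single 1 f').coeff h x = f x * a.coeff h x * f' (h⁻¹ • x) := by
  simp [coeff_mul_single, coeff_single_mul]

theorem ext_apply {a b : CrossedProduct R G X} (h : ∀ g x, a.coeff g x = b.coeff g x) : a = b :=
  SkewMonoidAlgebra.ext fun g => LocConstCc.ext (h g)

/-- The two-sided ideal of all `∑ f_g δ_g` with `f_g x ∈ 𝔞 x` for all `g` and `x`, for a family of
ideals `𝔞 x` of `R` that is constant on the orbits. -/
noncomputable def coeffIdeal (𝔞 : X → Ideal R) (h𝔞 : ∀ (g : G) x, 𝔞 (g • x) = 𝔞 x) :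
    TwoSidedIdeal (CrossedProduct R G X) :=
  .mk' {a | ∀ g x, a.coeff g x ∈ 𝔞 x}
    (fun g x => by simp [LocConstCc.zero_apply])
    (fun {a b} ha hb g x => by
      rw [coeff_add, Finsupp.add_apply, LocConstCc.add_apply]
      exact add_mem (ha g x) (hb g x))
    (fun {a} ha g x => by
      rw [coeff_neg, Finsupp.neg_apply]
      exact neg_mem (ha g x))
    (fun {a b} hb => by
      induction a using SkewMonoidAlgebra.induction_on with
      | zero => intro g x; simp [LocConstCc.zero_apply]
      | add a a' ha ha' =>
        intro g x
        rw [add_mul, coeff_add, Finsupp.add_apply, LocConstCc.add_apply]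
        exact add_mem (ha g x) (ha' g x)
      | single k f =>
        intro g x
        rw [coeff_single_mul]
        exact Ideal.mul_mem_left _ _ (h𝔞 k⁻¹ x ▸ hb _ _))
    (fun {a b} ha => by
      induction b using SkewMonoidAlgebra.induction_on with
      | zero => intro g x; simp [LocConstCc.zero_apply]
      | add b b' hb hb' =>
        intro g x
        rw [mul_add, coeff_add, Finsupp.add_apply, LocConstCc.add_apply]
        exact add_mem (hb g x) (hb' g x)
      | single k f =>
        intro g x
        rw [coeff_mul_single]
        exact Ideal.mul_mem_right _ _ (ha _ _))

theorem mem_coeffIdeal {𝔞 : X → Ideal R} {h𝔞 : ∀ (g : G) x, 𝔞 (g • x) = 𝔞 x}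
    {a : CrossedProduct R G X} : a ∈ coeffIdeal 𝔞 h𝔞 ↔ ∀ g x, a.coeff g x ∈ 𝔞 x :=
  TwoSidedIdeal.mem_mk' ..

theorem mul_eq_zero_of_mem_coeffIdeal {𝔞 𝔟 : X → Ideal R} {h𝔞 : ∀ (g : G) x, 𝔞 (g • x) = 𝔞 x}
    {h𝔟 : ∀ (g : G) x, 𝔟 (g • x) = 𝔟 x} (h : ∀ x, ∀ p ∈ 𝔞 x, ∀ q ∈ 𝔟 x, p * q = 0)
    {a b : CrossedProduct R G X} (ha : a ∈ coeffIdeal 𝔞 h𝔞) (hb : b ∈ coeffIdeal 𝔟 h𝔟) :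
    a * b = 0 := by
  rw [mem_coeffIdeal] at ha hb
  rw [mul_def, sum_def']
  refine Finset.sum_eq_zero fun g _ => ?_
  rw [sum_def']
  refine Finset.sum_eq_zero fun k _ => ?_
  rw [single_eq_zero]
  ext x
  exact h x _ (ha g x) _ (h𝔟 g⁻¹ x ▸ hb k (g⁻¹ • x))

variable [T2Space X]

theorem indicator_mem_coeffIdeal {𝔞 : X → Ideal R} {h𝔞 : ∀ (g : G) x, 𝔞 (g • x) = 𝔞 x}
    {U : CompactOpens X} {r : R} (h : ∀ x ∈ U, r ∈ 𝔞 x) :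
    single 1 (LocConstCc.indicator U r) ∈ coeffIdeal 𝔞 h𝔞 := by
  classical
  rw [mem_coeffIdeal]
  intro g x
  rw [coeff_single_apply]
  split_ifs
  · by_cases hx : x ∈ U
    · rw [LocConstCc.indicator_of_mem hx]
      exact h x hx
    · rw [LocConstCc.indicator_of_notMem hx]
      exact zero_mem _
  · exact zero_mem _

/-- An ideal `coeffIdeal 𝔞` is zero only if `𝔞` contains no nonzero scalar over a nonempty compact
open set. -/
theorem eq_zero_of_coeffIdeal_eq_bot {𝔞 : X → Ideal R} {h𝔞 : ∀ (g : G) x, 𝔞 (g • x) = 𝔞 x}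
    (hbot : coeffIdeal 𝔞 h𝔞 = ⊥) {U : CompactOpens X} {r : R} (h : ∀ x ∈ U, r ∈ 𝔞 x) {x : X}
    (hx : x ∈ U) : r = 0 := by
  have hmem := indicator_mem_coeffIdeal (h𝔞 := h𝔞) h
  rw [hbot, TwoSidedIdeal.mem_bot, single_eq_zero] at hmem
  rw [← LocConstCc.indicator_of_mem hx r, hmem, LocConstCc.zero_apply]

/-! ### Nonzero ideals under topological freeness -/

/-- Inside a nonempty open set there is a nonempty open set which is moved off itself by each of
finitely many given nontrivial group elements. -/
theorem exists_compactOpens_forall_smul_notMem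
    (hbasis : IsTopologicalBasis {U : Set X | IsCompact U ∧ IsOpen U})
    (hfree : IsTopologicallyFree G X) (F : Finset G) {W : Set X} (hW : IsOpen W)
    (hne : W.Nonempty) :
    ∃ V : CompactOpens X, (V : Set X).Nonempty ∧ (V : Set X) ⊆ W ∧
      ∀ g ∈ F, g ≠ 1 → ∀ x ∈ V, g • x ∉ V := by
  classical
  have := locallyCompactSpace_of_compactOpen_basis hbasis
  have hmeagre : IsMeagre (⋃ g ∈ {g ∈ F | g ≠ 1}, MulAction.fixedBy X g) :=
    isMeagre_biUnion (Finset.countable_toSet _)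
      fun g hg => (hfree g (Finset.mem_filter.1 hg).2).isMeagre
  obtain ⟨y, hyW, hy⟩ : ∃ y ∈ W, y ∉ ⋃ g ∈ {g ∈ F | g ≠ 1}, MulAction.fixedBy X g := by
    by_contra! h
    exact not_isMeagre_of_isOpen hW hne (hmeagre.mono h)
  have hsep : ∀ g ∈ {g ∈ F | g ≠ 1}, ∃ N ∈ 𝓝 y, ∀ z ∈ N, g • z ∉ N := by
    intro g hg
    have hgy : y ≠ g • y := fun h => hy (mem_biUnion hg h.symm)
    obtain ⟨A, B, hA, hB, hyA, hyB, hAB⟩ := t2_separation hgy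
    refine ⟨A ∩ (g • ·) ⁻¹' B, Filter.inter_mem (hA.mem_nhds hyA)
      ((hB.preimage (continuous_const_smul g)).mem_nhds hyB), fun z hz hgz => ?_⟩
    exact hAB.le_bot ⟨hgz.1, hz.2⟩
  choose! N hN hNg using hsep
  obtain ⟨V, hyV, hV⟩ := exists_compactOpens_mem_subset hbasis
    (Filter.inter_mem (hW.mem_nhds hyW) ((Filter.biInter_finset_mem _).2 hN))
  refine ⟨V, ⟨y, hyV⟩, fun z hz => (hV hz).1, fun g hg hg1 x hx hgx => ?_⟩
  have hg' : g ∈ {g ∈ F | g ≠ 1} := Finset.mem_filter.2 ⟨hg, hg1⟩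
  exact hNg g hg' x (mem_iInter₂.1 (hV hx).2 g hg') (mem_iInter₂.1 (hV hgx).2 g hg')

/-- The ideal intersection property: for a topologically free action every nonzero two-sided ideal
contains some `r 1_V δ_1` with `r ≠ 0` and `V` nonempty. If the coefficient of `δ_1` in an element
`b` of the ideal is `r` on `V`, and `V` is moved off itself by the other elements of the support of
`b`, then `1_V b 1_V = r 1_V δ_1`. -/
theorem exists_single_one_indicator_mem
    (hbasis : IsTopologicalBasis {U : Set X | IsCompact U ∧ IsOpen U})
    (hfree : IsTopologicallyFree G X) {I : TwoSidedIdeal (CrossedProduct R G X)} (hI : I ≠ ⊥) :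
    ∃ (V : CompactOpens X) (r : R), (V : Set X).Nonempty ∧ r ≠ 0 ∧
      single 1 (LocConstCc.indicator V r) ∈ I := by
  classical
  obtain ⟨a, haI, ha⟩ : ∃ a ∈ I, a ≠ 0 := by
    by_contra! h
    exact hI (le_bot_iff.1 fun a ha => (TwoSidedIdeal.mem_bot _).2 (h a ha))
  obtain ⟨g, x, hgx⟩ : ∃ g x, a.coeff g x ≠ 0 := by
    by_contra! h
    exact ha (ext_apply h)
  obtain ⟨U, hxU, -⟩ := exists_compactOpens_mem_subset hbasis
    (Filter.univ_mem (f := 𝓝 (g⁻¹ • x)))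
  -- Multiplying by `1_U δ_{g⁻¹}` moves the nonzero coefficient to the identity of `G`.
  set b : CrossedProduct R G X := a * single g⁻¹ (LocConstCc.indicator U 1) with hb
  have hbI : b ∈ I := I.mul_mem_right _ _ haI
  have hbx : b.coeff 1 x ≠ 0 := by
    rw [hb, coeff_mul_single]
    simpa [LocConstCc.indicator_of_mem hxU] using hgx
  obtain ⟨V, hVne, hVW, hV⟩ := exists_compactOpens_forall_smul_notMem hbasis hfree b.support
    ((b.coeff 1).isLocallyConstant.isOpen_fiber (b.coeff 1 x)) ⟨x, rfl⟩
  refine ⟨V, b.coeff 1 x, hVne, hbx, ?_⟩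
  convert I.mul_mem_right _ (single 1 (LocConstCc.indicator V 1))
    (I.mul_mem_left (single 1 (LocConstCc.indicator V 1)) _ hbI) using 1
  refine ext_apply fun h z => ?_
  rw [coeff_single_one_mul_mul_single_one, coeff_single_apply]
  by_cases hz : z ∈ V
  · rw [LocConstCc.indicator_of_mem hz, one_mul]
    split_ifs with h1
    · subst h1
      simp only [inv_one, one_smul, LocConstCc.indicator_of_mem hz, mul_one]
      exact (hVW hz).symm
    · rw [LocConstCc.zero_apply]
      by_cases hh : h ∈ b.support
      · rw [LocConstCc.indicator_of_notMem, mul_zero]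
        intro hz'
        exact hV h hh (Ne.symm h1) _ hz' (by simpa using hz)
      · rw [notMem_support_iff.1 hh, LocConstCc.zero_apply, zero_mul]
  · rw [LocConstCc.indicator_of_notMem hz, zero_mul, zero_mul]
    split_ifs
    · exact LocConstCc.indicator_of_notMem hz _
    · rfl

/-! ### Primeness -/

theorem isDomain_of_isPrimeRing [Nonempty X]
    (hbasis : IsTopologicalBasis {U : Set X | IsCompact U ∧ IsOpen U})
    (h : IsPrimeRing (CrossedProduct R G X)) : IsDomain R := by
  obtain ⟨hnt, hprime⟩ := h
  have : Nontrivial R := by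
    by_contra hR
    rw [not_nontrivial_iff_subsingleton] at hR
    exact not_subsingleton (CrossedProduct R G X)
      ⟨fun a b => ext_apply fun g x => Subsingleton.elim _ _⟩
  have : NoZeroDivisors R := by
    refine ⟨fun {r s} hrs => ?_⟩
    obtain ⟨x⟩ := ‹Nonempty X›
    obtain ⟨U, hx, -⟩ := exists_compactOpens_mem_subset hbasis (Filter.univ_mem (f := 𝓝 x))
    refine (hprime (coeffIdeal (fun _ => Ideal.span {r}) fun _ _ => rfl)
      (coeffIdeal (fun _ => Ideal.span {s}) fun _ _ => rfl) fun a ha b hb =>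
        mul_eq_zero_of_mem_coeffIdeal (fun _ p hp q hq => ?_) ha hb).imp
      (fun hI => eq_zero_of_coeffIdeal_eq_bot hI
        (fun _ _ => Ideal.mem_span_singleton_self _) hx)
      (fun hJ => eq_zero_of_coeffIdeal_eq_bot hJ
        (fun _ _ => Ideal.mem_span_singleton_self _) hx)
    obtain ⟨c, rfl⟩ := Ideal.mem_span_singleton.1 hp
    obtain ⟨d, rfl⟩ := Ideal.mem_span_singleton.1 hq
    rw [mul_mul_mul_comm, hrs, zero_mul]
  exact NoZeroDivisors.to_isDomain R

end CrossedProduct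

section Saturation

variable {G X R : Type*} [Group G] [MulAction G X] [CommRing R]

open Classical in
/-- The family of ideals of `R` that is everything over the `G`-saturation of `U` and zero
elsewhere; its coefficient ideal consists of the elements supported in the saturation. -/
noncomputable def saturationFiber (G R : Type*) [Group G] [MulAction G X] [CommRing R]
    (U : Set X) (x : X) : Ideal R :=
  if ∃ g : G, g • x ∈ U then ⊤ else ⊥

theorem saturationFiber_smul (U : Set X) (g : G) (x : X) :
    saturationFiber G R U (g • x) = saturationFiber G R U x := by
  have h : (∃ k : G, k • g • x ∈ U) ↔ ∃ k : G, k • x ∈ U :=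
    ⟨fun ⟨k, hk⟩ => ⟨k * g, by rwa [mul_smul]⟩, fun ⟨k, hk⟩ => ⟨k * g⁻¹, by simpa [mul_smul]⟩⟩
  by_cases hx : ∃ k : G, k • x ∈ U
  · rw [saturationFiber, saturationFiber, if_pos hx, if_pos (h.2 hx)]
  · rw [saturationFiber, saturationFiber, if_neg hx, if_neg (mt h.1 hx)]

theorem mem_saturationFiber_of_mem {U : Set X} {x : X} (hx : x ∈ U) (r : R) :
    r ∈ saturationFiber G R U x := by
  rw [saturationFiber, if_pos ⟨1, by simpa⟩]
  exact Submodule.mem_top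

theorem eq_zero_of_mem_saturationFiber {U : Set X} {x : X} {r : R}
    (hr : r ∈ saturationFiber G R U x) (hx : ¬ ∃ g : G, g • x ∈ U) : r = 0 := by
  rwa [saturationFiber, if_neg hx] at hr

end Saturation

namespace CrossedProduct

open SkewMonoidAlgebra

variable {G X R : Type*} [Group G] [TopologicalSpace X] [T2Space X] [MulAction G X]
  [ContinuousConstSMul G X] [CommRing R]

theorem isTopologicallyTransitive_of_isPrimeRing [Nontrivial R]
    (hbasis : IsTopologicalBasis {U : Set X | IsCompact U ∧ IsOpen U})
    (h : IsPrimeRing (CrossedProduct R G X)) : MulAction.IsTopologicallyTransitive G X := by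
  rw [MulAction.isTopologicallyTransitive_iff]
  rintro U V hU ⟨x, hx⟩ hV ⟨y, hy⟩
  by_contra! hUV
  obtain ⟨U', hxU', hU'⟩ := exists_compactOpens_mem_subset hbasis (hU.mem_nhds hx)
  obtain ⟨V', hyV', hV'⟩ := exists_compactOpens_mem_subset hbasis (hV.mem_nhds hy)
  -- A point cannot lie in the saturations of both `U` and `V`.
  have hzero : ∀ z, ∀ p ∈ saturationFiber G R U z, ∀ q ∈ saturationFiber G R V z, p * q = 0 := by
    intro z p hp q hq
    by_cases hzU : ∃ g : G, g • z ∈ U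
    · obtain ⟨g, hg⟩ := hzU
      rw [eq_zero_of_mem_saturationFiber hq, mul_zero]
      rintro ⟨k, hk⟩
      refine (hUV (k * g⁻¹)).subset ⟨mem_smul_set.2 ⟨g • z, hg, ?_⟩, hk⟩
      simp [mul_smul]
    · rw [eq_zero_of_mem_saturationFiber hp hzU, zero_mul]
  rcases h.2 (coeffIdeal (saturationFiber G R U) (saturationFiber_smul U))
      (coeffIdeal (saturationFiber G R V) (saturationFiber_smul V))
      fun a ha b hb => mul_eq_zero_of_mem_coeffIdeal hzero ha hb with hI | hJ
  · exact one_ne_zero (eq_zero_of_coeffIdeal_eq_bot hI (r := (1 : R))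
      (fun z hz => mem_saturationFiber_of_mem (hU' hz) _) hxU')
  · exact one_ne_zero (eq_zero_of_coeffIdeal_eq_bot hJ (r := (1 : R))
      (fun z hz => mem_saturationFiber_of_mem (hV' hz) _) hyV')

theorem isPrimeRing_of_isTopologicallyTransitive [Nonempty X] [IsDomain R]
    (hbasis : IsTopologicalBasis {U : Set X | IsCompact U ∧ IsOpen U})
    (hfree : IsTopologicallyFree G X) (htrans : MulAction.IsTopologicallyTransitive G X) :
    IsPrimeRing (CrossedProduct R G X) := by
  constructor
  · obtain ⟨x⟩ := ‹Nonempty X›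
    obtain ⟨U, hx, -⟩ := exists_compactOpens_mem_subset hbasis (Filter.univ_mem (f := 𝓝 x))
    refine ⟨single 1 (LocConstCc.indicator U 1), 0, fun h => one_ne_zero (α := R) ?_⟩
    rw [single_eq_zero] at h
    rw [← LocConstCc.indicator_of_mem hx 1, h, LocConstCc.zero_apply]
  · intro I J hIJ
    by_contra! hne
    obtain ⟨V, r, hV, hr, hrI⟩ := exists_single_one_indicator_mem hbasis hfree hne.1
    obtain ⟨W, s, hW, hs, hsJ⟩ := exists_single_one_indicator_mem hbasis hfree hne.2
    obtain ⟨g, -, ⟨v, hv, rfl⟩, hgv⟩ :=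
      (MulAction.isTopologicallyTransitive_iff G).1 htrans V.isOpen hV W.isOpen hW
    -- `(r 1_V δ_1) (1_V δ_{g⁻¹}) (s 1_W δ_1) = r s 1_{V ∩ g⁻¹ W} δ_{g⁻¹}` does not vanish at `v`.
    have h0 := hIJ _ (I.mul_mem_right _ (single g⁻¹ (LocConstCc.indicator V 1)) hrI) _ hsJ
    rw [single_mul_single, single_mul_single, single_eq_zero] at h0
    have hv0 := congrArg (fun f : LocConstCc X R => f v) h0
    simp only [LocConstCc.mul_apply, LocConstCc.smul_apply, LocConstCc.zero_apply,
      one_smul, one_mul, inv_inv, LocConstCc.indicator_of_mem (show v ∈ V from hv),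
      LocConstCc.indicator_of_mem (show g • v ∈ W from hgv), mul_one] at hv0
    exact mul_ne_zero hr hs hv0

end CrossedProduct

/-! ### The representation on an orbit -/

section Representation

variable {A M : Type*} [NonUnitalRing A] [AddCommGroup M] (ρ : A →ₙ+* AddMonoid.End M)

theorem representation_zero_apply (m : M) : ρ 0 m = 0 := by
  rw [map_zero]
  rfl

theorem representation_add_apply (a b : A) (m : M) : ρ (a + b) m = ρ a m + ρ b m := by
  rw [map_add]
  rfl

theorem representation_mul_apply (a b : A) (m : M) : ρ (a * b) m = ρ a (ρ b m) := by
  rw [map_mul]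
  rfl

end Representation

/-- A faithful irreducible module in a universe below that of the ring witnesses primitivity. -/
theorem isPrimitiveRing_of_irreducible_faithful.{u, v} {A : Type (max u v)} [NonUnitalRing A]
    {M : Type v} [AddCommGroup M] (ρ : A →ₙ+* AddMonoid.End M) (hinj : Function.Injective ρ)
    (hne : ∃ a m, ρ a m ≠ 0)
    (hirr : ∀ N : AddSubgroup M, (∀ a, ∀ m ∈ N, ρ a m ∈ N) → N = ⊥ ∨ N = ⊤) :
    IsPrimitiveRing A := by
  let e : ULift.{u} M ≃+ M := AddEquiv.ulift
  let σ : A →ₙ+* AddMonoid.End (ULift.{u} M) :=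
    { toFun a := e.symm.toAddMonoidHom.comp ((ρ a).comp e.toAddMonoidHom)
      map_zero' := by
        ext1 m
        change e.symm (ρ 0 (e m)) = 0
        rw [representation_zero_apply, map_zero]
      map_add' a b := by
        ext1 m
        change e.symm (ρ (a + b) (e m)) = e.symm (ρ a (e m)) + e.symm (ρ b (e m))
        rw [representation_add_apply, map_add]
      map_mul' a b := by
        ext1 m
        change e.symm (ρ (a * b) (e m)) = e.symm (ρ a (e (e.symm (ρ b (e m)))))
        rw [representation_mul_apply, AddEquiv.apply_symm_apply] }
  have hσ : ∀ a m, σ a m = e.symm (ρ a (e m)) := fun _ _ => rfl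
  refine ⟨ULift.{u} M, inferInstance, σ, fun a b hab => hinj ?_, ?_, fun N hN => ?_⟩
  · ext m
    have := DFunLike.congr_fun hab (e.symm m)
    simpa [hσ] using this
  · obtain ⟨a, m, h⟩ := hne
    exact ⟨a, e.symm m, by simpa [hσ] using h⟩
  · have hmem : ∀ m, m ∈ N.map e.toAddMonoidHom ↔ e.symm m ∈ N := fun m =>
      AddSubgroup.mem_map_equiv
    refine (hirr (N.map e.toAddMonoidHom) fun a m hm => ?_).imp (fun h => ?_) (fun h => ?_)
    · rw [hmem] at hm ⊢
      simpa [hσ] using hN a _ hm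
    · exact (AddSubgroup.map_eq_bot_iff_of_injective _ e.injective).1 h
    · refine eq_top_iff.2 fun m _ => ?_
      have := (hmem (e m)).1 (h ▸ AddSubgroup.mem_top _)
      simpa using this

namespace CrossedProduct

open SkewMonoidAlgebra

variable {G X R : Type*} [Group G] [TopologicalSpace X] [MulAction G X] [CommRing R]

/-- The operator `f δ_g` on the free `R`-module on the orbit of `x`, additively in `f`: it sends the
basis vector `y` to `f (g • y)` times the basis vector `g • y`. -/
noncomputable def orbitOperator (x : X) (g : G) :
    LocConstCc X R →+ AddMonoid.End (MulAction.orbit G x →₀ R) where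
  toFun f := Finsupp.liftAddHom fun y =>
    (Finsupp.singleAddHom (g • y)).comp (AddMonoidHom.mulLeft (f (g • y : X)))
  map_zero' := by
    refine Finsupp.addHom_ext fun y c => ?_
    rw [Finsupp.liftAddHom_apply_single]
    simp only [LocConstCc.zero_apply, AddMonoidHom.comp_apply, AddMonoidHom.coe_mulLeft, zero_mul,
      map_zero]
    rfl
  map_add' f f' := by
    refine Finsupp.addHom_ext fun y c => ?_
    refine Eq.trans ?_ (AddMonoidHom.add_apply _ _ _).symm
    simp only [Finsupp.liftAddHom_apply_single, LocConstCc.add_apply, AddMonoidHom.comp_apply,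
      AddMonoidHom.coe_mulLeft, add_mul, map_add]

theorem orbitOperator_single (x : X) (g : G) (f : LocConstCc X R) (y : MulAction.orbit G x)
    (c : R) : orbitOperator x g f (.single y c) = .single (g • y) (f (g • y : X) * c) :=
  Finsupp.liftAddHom_apply_single _ _ _

variable [ContinuousConstSMul G X]

/-- The additive map underlying `orbitRep`. -/
noncomputable def orbitRepAux (x : X) :
    CrossedProduct R G X →+ AddMonoid.End (MulAction.orbit G x →₀ R) :=
  (Finsupp.liftAddHom (orbitOperator x)).comp coeffAddEquiv.toAddMonoidHom

theorem orbitRepAux_single_single (x : X) (g : G) (f : LocConstCc X R) (y : MulAction.orbit G x)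
    (c : R) :
    orbitRepAux x (single g f) (.single y c) = .single (g • y) (f (g • y : X) * c) := by
  have h : orbitRepAux x (single g f) = orbitOperator x g f :=
    Finsupp.liftAddHom_apply_single _ _ _
  rw [h, orbitOperator_single]

/-- The representation of the crossed product on the free `R`-module on the orbit of `x`, in which
`f δ_g` sends the basis vector `y` to `f (g • y)` times the basis vector `g • y`. -/
noncomputable def orbitRep (x : X) :
    CrossedProduct R G X →ₙ+* AddMonoid.End (MulAction.orbit G x →₀ R) where
  __ := orbitRepAux x
  map_zero' := map_zero _
  map_mul' a b := by
    change orbitRepAux x (a * b) = orbitRepAux x a * orbitRepAux x b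
    induction a using SkewMonoidAlgebra.induction_on with
    | zero => simp
    | add a a' ha ha' => simp [add_mul, ha, ha']
    | single g f =>
      induction b using SkewMonoidAlgebra.induction_on with
      | zero => simp
      | add b b' hb hb' => simp [mul_add, hb, hb']
      | single g' f' =>
        refine Finsupp.addHom_ext fun y c => ?_
        rw [single_mul_single]
        change orbitRepAux x _ (.single y c) = orbitRepAux x _ (orbitRepAux x _ (.single y c))
        rw [orbitRepAux_single_single, orbitRepAux_single_single, orbitRepAux_single_single,
          LocConstCc.mul_apply, LocConstCc.smul_apply, mul_smul, mul_smul, inv_smul_smul, mul_assoc]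
        rfl

theorem orbitRep_single_single (x : X) (g : G) (f : LocConstCc X R) (y : MulAction.orbit G x)
    (c : R) :
    orbitRep x (single g f) (.single y c) = .single (g • y) (f (g • y : X) * c) :=
  orbitRepAux_single_single x g f y c

theorem orbitRep_single_one_apply (x : X) (f : LocConstCc X R) (m : MulAction.orbit G x →₀ R)
    (y : MulAction.orbit G x) : orbitRep x (single 1 f) m y = f y * m y := by
  classical
  induction m using Finsupp.induction_linear with
  | zero => simp
  | add m m' hm hm' => simp [mul_add, hm, hm']
  | single z c =>
    rw [orbitRep_single_single, one_smul, Finsupp.single_apply, Finsupp.single_apply]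
    split_ifs with h
    · rw [h, one_smul]
    · rw [mul_zero]

variable [T2Space X]

theorem orbitRep_injective (hbasis : IsTopologicalBasis {U : Set X | IsCompact U ∧ IsOpen U})
    (hfree : IsTopologicallyFree G X) {x : X} (hx : Dense (MulAction.orbit G x)) :
    Function.Injective (orbitRep (R := R) (G := G) x) := by
  rw [← TwoSidedIdeal.ker_eq_bot]
  by_contra hker
  obtain ⟨V, r, hV, hr, hmem⟩ := exists_single_one_indicator_mem hbasis hfree hker
  obtain ⟨y, hyV, hy⟩ := hx.inter_open_nonempty V V.isOpen hV
  rw [TwoSidedIdeal.mem_ker] at hmem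
  have h := orbitRep_single_one_apply x (LocConstCc.indicator V r) (.single ⟨y, hy⟩ 1) ⟨y, hy⟩
  rw [hmem, LocConstCc.indicator_of_mem (show y ∈ V from hyV)] at h
  simp at h
  exact hr h.symm

/-- Over a field the representation on an orbit is irreducible: the points of the support of a
vector can be separated by compact open sets, and `G` permutes the basis vectors transitively. -/
theorem orbitRep_irreducible (hbasis : IsTopologicalBasis {U : Set X | IsCompact U ∧ IsOpen U})
    (hR : IsField R) (x : X) (N : AddSubgroup (MulAction.orbit G x →₀ R))
    (hN : ∀ a, ∀ m ∈ N, orbitRep (R := R) x a m ∈ N) : N = ⊥ ∨ N = ⊤ := by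
  classical
  refine or_iff_not_imp_left.2 fun hbot => eq_top_iff.2 fun n _ => ?_
  obtain ⟨⟨m, hmN⟩, hm⟩ := AddSubgroup.ne_bot_iff_exists_ne_zero.1 hbot
  replace hm : m ≠ 0 := fun h => hm (Subtype.ext h)
  obtain ⟨y, hy⟩ := Finsupp.ne_iff.1 hm
  have hys : ((m.support.erase y).image ((↑) : _ → X) : Set X)ᶜ ∈ 𝓝 (y : X) :=
    (Finset.finite_toSet _).isClosed.isOpen_compl.mem_nhds (by simp)
  obtain ⟨U, hyU, hU⟩ := exists_compactOpens_mem_subset hbasis hys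
  have hsingle : Finsupp.single y (m y) ∈ N := by
    convert hN (single 1 (LocConstCc.indicator U 1)) m hmN using 1
    ext z
    rw [orbitRep_single_one_apply, Finsupp.single_apply]
    split_ifs with h
    · rw [← h, LocConstCc.indicator_of_mem hyU, one_mul]
    · by_cases hz : m z = 0
      · rw [hz, mul_zero]
      · rw [LocConstCc.indicator_of_notMem, zero_mul]
        intro hzU
        exact hU hzU (Finset.mem_coe.2 (Finset.mem_image_of_mem _
          (Finset.mem_erase.2 ⟨Ne.symm h, Finsupp.mem_support_iff.2 hz⟩)))
  obtain ⟨c, hc⟩ := hR.mul_inv_cancel hy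
  induction n using Finsupp.induction_linear with
  | zero => exact zero_mem _
  | add n n' hn hn' => exact add_mem (hn trivial) (hn' trivial)
  | single z d =>
    obtain ⟨g, rfl⟩ := MulAction.exists_smul_eq G y z
    obtain ⟨V, hV, -⟩ := exists_compactOpens_mem_subset hbasis
      (Filter.univ_mem (f := 𝓝 ((g • y : MulAction.orbit G x) : X)))
    convert hN (single g (LocConstCc.indicator V (d * c))) _ hsingle using 1
    rw [orbitRep_single_single,
      LocConstCc.indicator_of_mem (show g • (y : X) ∈ V from hV), mul_assoc, mul_comm c, hc, mul_one]

end CrossedProduct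

theorem CrossedProduct.isPrimitiveRing_of_dense_orbit.{u, v, w} {G : Type u} {X : Type v}
    {R : Type w} [Group G] [TopologicalSpace X] [T2Space X] [MulAction G X]
    [ContinuousConstSMul G X] [CommRing R]
    (hbasis : TopologicalSpace.IsTopologicalBasis {U : Set X | IsCompact U ∧ IsOpen U})
    (hfree : IsTopologicallyFree G X) (hR : IsField R) {x : X}
    (hx : Dense (MulAction.orbit G x)) : IsPrimitiveRing (CrossedProduct R G X) := by
  refine isPrimitiveRing_of_irreducible_faithful.{max u v w, max v w} (orbitRep x)
    (orbitRep_injective hbasis hfree hx) ?_ (orbitRep_irreducible hbasis hR x)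
  have := hR.nontrivial
  obtain ⟨U, hU, -⟩ := exists_compactOpens_mem_subset hbasis (Filter.univ_mem (f := 𝓝 x))
  let y : MulAction.orbit G x := ⟨x, MulAction.mem_orbit_self x⟩
  refine ⟨SkewMonoidAlgebra.single 1 (LocConstCc.indicator U 1), .single y 1, fun h => ?_⟩
  have h1 := orbitRep_single_one_apply x (LocConstCc.indicator U (1 : R)) (.single y 1) y
  rw [h, LocConstCc.indicator_of_mem (show (y : X) ∈ U from hU)] at h1
  simp at h1

/-! ### Primitivity gives a dense orbit -/

namespace CrossedProduct

open SkewMonoidAlgebra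

variable {G X R : Type*} [Group G] [TopologicalSpace X] [T2Space X] [MulAction G X]
  [ContinuousConstSMul G X] [CommRing R]

/-- If every point has a compact open neighbourhood `W` with `1_W m = 0`, then the crossed product
annihilates `m`: finitely many of these neighbourhoods cover the support of a given function. -/
theorem apply_eq_zero_of_locally {M : Type*} [AddCommGroup M]
    (ρ : CrossedProduct R G X →ₙ+* AddMonoid.End M) {m : M}
    (h : ∀ x : X, ∃ W : CompactOpens X, x ∈ W ∧ ρ (single 1 (LocConstCc.indicator W 1)) m = 0)
    (a : CrossedProduct R G X) : ρ a m = 0 := by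
  have hmul : ∀ (a b : CrossedProduct R G X), ρ b m = 0 → ρ (a * b) m = 0 := fun a b hb => by
    rw [representation_mul_apply, hb, map_zero]
  have hcover : ∀ K : Set X, IsCompact K → ∃ W : CompactOpens X, K ⊆ W ∧
      ρ (single 1 (LocConstCc.indicator W 1)) m = 0 := by
    intro K hK
    refine hK.induction_on (p := fun K => ∃ W : CompactOpens X, K ⊆ W ∧
      ρ (single 1 (LocConstCc.indicator W 1)) m = 0) ?_ ?_ ?_ ?_
    · refine ⟨⊥, empty_subset _, ?_⟩
      have : LocConstCc.indicator (⊥ : CompactOpens X) (1 : R) = 0 :=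
        LocConstCc.ext fun x => LocConstCc.indicator_of_notMem (notMem_empty x) _
      rw [this, single_zero, representation_zero_apply]
    · rintro s t hst ⟨W, hW, hW0⟩
      exact ⟨W, hst.trans hW, hW0⟩
    · rintro s t ⟨V, hV, hV0⟩ ⟨W, hW, hW0⟩
      refine ⟨V ⊔ W, union_subset_union hV hW, ?_⟩
      have hWV : (single 1 (LocConstCc.indicator (W \ V) 1) : CrossedProduct R G X) =
          single 1 (LocConstCc.indicator (W \ V) 1) * single 1 (LocConstCc.indicator W 1) := by
        rw [single_mul_single, mul_one, one_smul,
          LocConstCc.indicator_mul_indicator_of_le sdiff_le]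
      rw [LocConstCc.indicator_sup, single_add, representation_add_apply, hV0, zero_add, hWV]
      exact hmul _ _ hW0
    · intro x _
      obtain ⟨W, hx, hW⟩ := h x
      exact ⟨W, mem_nhdsWithin_of_mem_nhds (W.isOpen.mem_nhds hx), W, subset_rfl, hW⟩
  induction a using SkewMonoidAlgebra.induction_on with
  | zero => exact representation_zero_apply ρ m
  | add a b ha hb => rw [representation_add_apply, ha, hb, add_zero]
  | single g f =>
    obtain ⟨W, hKW, hW⟩ := hcover _ (g⁻¹ • f).hasCompactSupport
    have hf : (single g f : CrossedProduct R G X) =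
        single g f * single 1 (LocConstCc.indicator W 1) := by
      rw [single_mul_single, mul_one]
      congr 1
      ext x
      rw [LocConstCc.mul_apply, LocConstCc.smul_apply]
      by_cases hx : g⁻¹ • x ∈ W
      · rw [LocConstCc.indicator_of_mem hx, mul_one]
      · have h0 := image_eq_zero_of_notMem_tsupport (fun h => hx (hKW h))
        rw [LocConstCc.smul_apply, inv_inv, smul_inv_smul] at h0
        rw [h0, zero_mul]
    rw [hf]
    exact hmul _ _ hW

/-- A point at which a nonzero vector `m` of a faithful irreducible module has a nonzero germ has a
dense orbit. If the orbit missed `V`, then `m = a 1_V m'` for some `a` and `m'`, and `1_W a 1_V = 0`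
for a neighbourhood `W` of the point. -/
theorem exists_dense_orbit_of_isPrimitiveRing [Nontrivial R]
    (hbasis : IsTopologicalBasis {U : Set X | IsCompact U ∧ IsOpen U})
    (h : IsPrimitiveRing (CrossedProduct R G X)) : ∃ x : X, Dense (MulAction.orbit G x) := by
  obtain ⟨M, _, ρ, hinj, ⟨a₀, m₀, hne⟩, hirr⟩ := h
  -- No nonzero vector is annihilated by the whole ring.
  have hann : ∀ m : M, (∀ a, ρ a m = 0) → m = 0 := by
    let N : AddSubgroup M :=
      { carrier := {m | ∀ a, ρ a m = 0}
        zero_mem' := fun a => map_zero _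
        add_mem' := fun hm hn a => by rw [map_add, hm, hn, add_zero]
        neg_mem' := fun hm a => by rw [map_neg, hm, neg_zero] }
    rcases hirr N fun a m hm b => by rw [hm, map_zero] with hN | hN
    · exact fun m hm => (AddSubgroup.mem_bot).1 (hN ▸ (show m ∈ N from hm))
    · exact (hne ((show m₀ ∈ N from hN ▸ AddSubgroup.mem_top _) a₀)).elim
  -- Every nonzero vector is cyclic.
  have hcyc : ∀ m : M, m ≠ 0 → ∀ n, ∃ a, ρ a m = n := by
    intro m hm
    let N : AddSubgroup M :=
      { carrier := range fun a => ρ a m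
        zero_mem' := ⟨0, representation_zero_apply ρ m⟩
        add_mem' := by
          rintro _ _ ⟨a, rfl⟩ ⟨b, rfl⟩
          exact ⟨a + b, representation_add_apply ρ a b m⟩
        neg_mem' := by
          rintro _ ⟨a, rfl⟩
          exact ⟨-a, by simp only [map_neg]; rfl⟩ }
    rcases hirr N (by rintro a _ ⟨b, rfl⟩; exact ⟨a * b, representation_mul_apply ρ a b m⟩)
      with hN | hN
    · refine (hm (hann m fun a => ?_)).elim
      exact (AddSubgroup.mem_bot).1 (hN ▸ (⟨a, rfl⟩ : ρ a m ∈ N))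
    · exact fun n => (hN ▸ AddSubgroup.mem_top n : n ∈ N)
  obtain ⟨x, hx⟩ : ∃ x : X, ∀ W : CompactOpens X, x ∈ W →
      ρ (single 1 (LocConstCc.indicator W 1)) m₀ ≠ 0 := by
    by_contra! hloc
    exact hne (apply_eq_zero_of_locally ρ hloc a₀)
  refine ⟨x, dense_iff_inter_open.2 fun U hU ⟨y, hy⟩ => ?_⟩
  by_contra hempty
  have hmiss : ∀ g : G, g • x ∉ U := fun g hg => hempty ⟨g • x, hg, g, rfl⟩
  obtain ⟨V, hyV, hVU⟩ := exists_compactOpens_mem_subset hbasis (hU.mem_nhds hy)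
  obtain ⟨m', hm'⟩ : ∃ m', ρ (single 1 (LocConstCc.indicator V 1)) m' ≠ 0 := by
    by_contra! h0
    have : single 1 (LocConstCc.indicator V (1 : R)) = (0 : CrossedProduct R G X) :=
      hinj (by ext m; rw [h0, representation_zero_apply])
    rw [single_eq_zero] at this
    refine one_ne_zero (α := R) ?_
    rw [← LocConstCc.indicator_of_mem hyV 1, this, LocConstCc.zero_apply]
  obtain ⟨a, ha⟩ := hcyc _ hm' m₀
  have hW : (⋂ g ∈ a.support, (g⁻¹ • · : X → X) ⁻¹' (V : Set X)ᶜ) ∈ 𝓝 x := by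
    refine (Filter.biInter_finset_mem _).2 fun g _ => ?_
    exact ((V.isCompact.isClosed.isOpen_compl).preimage
      (continuous_const_smul g⁻¹)).mem_nhds fun hgx => hmiss g⁻¹ (hVU hgx)
  obtain ⟨W, hxW, hW⟩ := exists_compactOpens_mem_subset hbasis hW
  refine hx W hxW ?_
  rw [← ha, ← representation_mul_apply, ← representation_mul_apply]
  have h0 : single 1 (LocConstCc.indicator W 1) * a * single 1 (LocConstCc.indicator V 1) =
      (0 : CrossedProduct R G X) := by
    refine ext_apply fun g z => ?_
    rw [coeff_single_one_mul_mul_single_one]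
    change _ = (0 : R)
    by_cases hz : z ∈ W
    · by_cases hg : g ∈ a.support
      · rw [LocConstCc.indicator_of_notMem (mem_iInter₂.1 (hW hz) g hg), mul_zero]
      · rw [notMem_support_iff.1 hg, LocConstCc.zero_apply, mul_zero, zero_mul]
    · rw [LocConstCc.indicator_of_notMem hz, zero_mul, zero_mul]
  rw [h0, representation_zero_apply]

end CrossedProduct

/-! ### Transitivity and dense orbits -/

section Transitive

variable {G X : Type*} [Group G] [TopologicalSpace X] [MulAction G X]

theorem isTopologicallyTransitive_of_dense_orbit {x : X} (hx : Dense (MulAction.orbit G x)) :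
    MulAction.IsTopologicallyTransitive G X := by
  rw [MulAction.isTopologicallyTransitive_iff]
  intro U V hU hUne hV hVne
  obtain ⟨_, hgU, g, rfl⟩ := hx.inter_open_nonempty U hU hUne
  obtain ⟨_, hkV, k, rfl⟩ := hx.inter_open_nonempty V hV hVne
  exact ⟨k * g⁻¹, k • x, mem_smul_set.2 ⟨g • x, hgU, by simp [mul_smul]⟩, hkV⟩

/-- In a second countable Baire space, a point in the intersection of the dense open saturations of
the members of a countable basis has a dense orbit. -/
theorem exists_dense_orbit_of_isTopologicallyTransitive [Nonempty X] [BaireSpace X]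
    [SecondCountableTopology X] [ContinuousConstSMul G X]
    (h : MulAction.IsTopologicallyTransitive G X) : ∃ x : X, Dense (MulAction.orbit G x) := by
  have hdense : Dense (⋂ U ∈ countableBasis X, ⋃ g : G, (g • · : X → X) ⁻¹' U) :=
    dense_biInter_of_isOpen
      (fun U hU => isOpen_iUnion fun g =>
        (isOpen_of_mem_countableBasis hU).preimage (continuous_const_smul g))
      (countable_countableBasis X)
      (fun U hU => (isOpen_of_mem_countableBasis hU).dense_iUnion_preimage_smul G
        (nonempty_of_mem_countableBasis hU))
  obtain ⟨x, hx⟩ := hdense.nonempty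
  refine ⟨x, (isBasis_countableBasis X).dense_iff.2 fun U hU _ => ?_⟩
  obtain ⟨g, hg⟩ := mem_iUnion.1 (mem_iInter₂.1 hx U hU)
  exact ⟨g • x, hg, g, rfl⟩

end Transitive

theorem mainTheorem11 {G X R : Type*} [Group G] [TopologicalSpace X] [T2Space X] [Nonempty X]
    [MulAction G X] [ContinuousConstSMul G X] [CommRing R]
    (hbasis : TopologicalSpace.IsTopologicalBasis {U : Set X | IsCompact U ∧ IsOpen U})
    (hfree : IsTopologicallyFree G X) :
    (IsPrimeRing (CrossedProduct R G X) ↔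
      IsDomain R ∧ MulAction.IsTopologicallyTransitive G X) ∧
    (IsField R →
      (IsPrimitiveRing (CrossedProduct R G X) ↔ ∃ x : X, Dense (MulAction.orbit G x))) ∧
    (IsField R → SecondCountableTopology X →
      (IsPrimeRing (CrossedProduct R G X) ↔ IsPrimitiveRing (CrossedProduct R G X))) := by
  have hprime : IsPrimeRing (CrossedProduct R G X) ↔
      IsDomain R ∧ MulAction.IsTopologicallyTransitive G X := by
    refine ⟨fun h => ?_, fun ⟨_, h⟩ =>
      CrossedProduct.isPrimeRing_of_isTopologicallyTransitive hbasis hfree h⟩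
    have := CrossedProduct.isDomain_of_isPrimeRing hbasis h
    exact ⟨this, CrossedProduct.isTopologicallyTransitive_of_isPrimeRing hbasis h⟩
  have hprim : IsField R →
      (IsPrimitiveRing (CrossedProduct R G X) ↔ ∃ x : X, Dense (MulAction.orbit G x)) := by
    intro hR
    have := hR.nontrivial
    exact ⟨CrossedProduct.exists_dense_orbit_of_isPrimitiveRing hbasis,
      fun ⟨_, hx⟩ => CrossedProduct.isPrimitiveRing_of_dense_orbit hbasis hfree hR hx⟩
  refine ⟨hprime, hprim, fun hR _ => ?_⟩
  have := locallyCompactSpace_of_compactOpen_basis hbasis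
  rw [hprime, hprim hR]
  exact ⟨fun h => exists_dense_orbit_of_isTopologicallyTransitive h.2,
    fun ⟨_, hx⟩ => ⟨hR.isDomain, isTopologicallyTransitive_of_dense_orbit hx⟩⟩
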